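/- All vector spaces and algebras are over $\mathbb{C}$; algebras are associative and unital, and homomorphisms are unital. A \emph{Fréchet algebra} is an algebra with a complete, metrizable, locally convex topology for which multiplication $A\times A\to A$ is continuous; left and right Fréchet $A$-modules and Fréchet $A$-bimodules are complete, metrizable, locally convex spaces with (unital) jointly continuous actions. For a right Fréchet $A$-module $M$ and a left Fréchet $A$-module $N$, let $M\widehat\otimes_A N$ be the quotient of the completed projective tensor product $M\widehat\otimes N$ by the closed linear span of the elements $x\cdot a\otimes y-x\otimes a\cdot y$ ($x\in M$, $a\in A$, $y\in N$). A complex of Fréchet modules is \emph{admissible} if it has a contracting homotopy consisting of continuous linear maps; a left Fréchet module $P$ is \emph{projective} if the functor of continuous module morphisms ${}_A\mathrm{h}(P,-)$ takes admissible sequences to exact sequences; a \emph{projective resolution} of $N$ is an admissible complex $0\leftarrow N\leftarrow Q_0\leftarrow Q_1\leftarrow\cdots$ of left Fréchet $A$-modules with all $Q_i$ projective. For $n\ge 0$ write $M\perp^n_A N$ if for some (equivalently, for each) projective resolution $0\leftarrow N\leftarrow Q_\bullet$ the sequence $$0\leftarrow M\widehat\otimes_A N\leftarrow M\widehat\otimes_A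 Q_0\leftarrow\cdots\leftarrow M\widehat\otimes_A Q_{n+1}$$ is exact (no condition being imposed at the last term $M\widehat\otimes_A Q_{n+1}$); equivalently, $\operatorname{Tor}^A_m(M,N)=0$ for $1\le m\le n$ and $\operatorname{Tor}_0^A(M,N)$ is Hausdorff. For a Fréchet $A$-bimodule $X$, $\operatorname{Der}(A,X)$ denotes the space of all continuous linear maps $D\colon A\to X$ with $D(ab)=a\cdot D(b)+D(a)\cdot b$ for all $a,b\in A$. \textbf{Lemma.} Let $\varphi\colon A\to B$ be a continuous homomorphism of Fréchet algebras that is an epimorphism in the category of Fréchet algebras and continuous homomorphisms (i.e., for all continuous homomorphisms $\psi,\psi'\colon B\to C$ of Fréchet algebras, $\psi\varphi=\psi'\varphi$ implies $\psi=\psi'$). Let $\epsilon\colon B\to\mathbb{C}$ be a continuous homomorphism, and let $\mathbb{C}_\epsilon$ be the one-dimensional Fréchet $B$-bimodule $\mathbb{C}$ with $b\cdot z=z\cdot b=\epsilon(b)z$; via $\varphi$, $B$ is regarded as a right Fréchet $A$-module and $\mathbb{C}_\epsilon$ as a left Fréchet $A$-module and as a Fréchet $A$-bimodule. If $B\perp^1_A\mathbb{C}_\epsilon$,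 then the linear map $$\widetilde\varphi_{\mathbb{C}_\epsilon}\colon\operatorname{Der}(B,\mathbb{C}_\epsilon)\to\operatorname{Der}(A,\mathbb{C}_\epsilon),\qquad D\mapsto D\circ\varphi,$$ is a bijection. -/

import Mathlib

open scoped TensorProduct

universe u v w

/-! ### Fréchet spaces, algebras and modules -/

/-- A complex Fréchet space: a complete, metrizable (Hausdorff with a countable basis of
uniformity), locally convex topological vector space over `ℂ`. -/
class FrechetSpace (E : Type u) [AddCommGroup E] [Module ℂ E] [UniformSpace E] : Prop extends
    IsUniformAddGroup E, ContinuousSMul ℂ E, CompleteSpace E, T2Space E,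
    LocallyConvexSpace ℝ E where
  countablyGenerated : (uniformity E).IsCountablyGenerated

/-- A Fréchet algebra: a unital associative complex algebra on a Fréchet space, with (jointly)
continuous multiplication. -/
class FrechetAlgebra (A : Type u) [Ring A] [Algebra ℂ A] [UniformSpace A] : Prop extends
    FrechetSpace A, ContinuousMul A

instance : FrechetSpace ℂ where
  countablyGenerated := inferInstance

instance : FrechetAlgebra ℂ where

/-- A left Fréchet module over `A`. -/
structure LeftFrechetModule (A : Type u) [Ring A] [Algebra ℂ A] [UniformSpace A] where
  carrier : Type v
  [addCommGroup : AddCommGroup carrier]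
  [moduleComplex : Module ℂ carrier]
  [uniformSpace : UniformSpace carrier]
  [frechetSpace : FrechetSpace carrier]
  [moduleLeft : Module A carrier]
  [isScalarTowerLeft : IsScalarTower ℂ A carrier]
  [continuousSMulLeft : ContinuousSMul A carrier]

attribute [instance] LeftFrechetModule.addCommGroup LeftFrechetModule.moduleComplex
  LeftFrechetModule.uniformSpace LeftFrechetModule.frechetSpace LeftFrechetModule.moduleLeft
  LeftFrechetModule.isScalarTowerLeft LeftFrechetModule.continuousSMulLeft

/-- A right Fréchet module over `A`; `x · a` is `MulOpposite.op a • x`. -/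
structure RightFrechetModule (A : Type u) [Ring A] [Algebra ℂ A] [UniformSpace A] where
  carrier : Type v
  [addCommGroup : AddCommGroup carrier]
  [moduleComplex : Module ℂ carrier]
  [uniformSpace : UniformSpace carrier]
  [frechetSpace : FrechetSpace carrier]
  [moduleRight : Module Aᵐᵒᵖ carrier]
  [isScalarTowerRight : IsScalarTower ℂ Aᵐᵒᵖ carrier]
  [continuousSMulRight : ContinuousSMul Aᵐᵒᵖ carrier]

attribute [instance] RightFrechetModule.addCommGroup RightFrechetModule.moduleComplex
  RightFrechetModule.uniformSpace RightFrechetModule.frechetSpace RightFrechetModule.moduleRight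
  RightFrechetModule.isScalarTowerRight RightFrechetModule.continuousSMulRight

/-- A Fréchet `A`-bimodule: a left Fréchet module with a commuting right Fréchet module
structure. -/
structure FrechetBimodule (A : Type u) [Ring A] [Algebra ℂ A] [UniformSpace A]
    extends LeftFrechetModule.{u, v} A where
  [moduleRight : Module Aᵐᵒᵖ carrier]
  [isScalarTowerRight : IsScalarTower ℂ Aᵐᵒᵖ carrier]
  [continuousSMulRight : ContinuousSMul Aᵐᵒᵖ carrier]
  [smulCommClass : SMulCommClass A Aᵐᵒᵖ carrier]

attribute [instance] FrechetBimodule.moduleRight FrechetBimodule.isScalarTowerRight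
  FrechetBimodule.continuousSMulRight FrechetBimodule.smulCommClass

section Objects

variable {A : Type u} [Ring A] [Algebra ℂ A] [UniformSpace A]
  {B : Type v} [Ring B] [Algebra ℂ B] [UniformSpace B]

/-- `B` as a right Fréchet module over itself. -/
def RightFrechetModule.regular (B : Type v) [Ring B] [Algebra ℂ B] [UniformSpace B]
    [FrechetAlgebra B] : RightFrechetModule.{v, v} B where
  carrier := B

/-- Restriction of scalars along a continuous homomorphism `φ : A → B`: `a · x = φ a · x`. -/
def LeftFrechetModule.restrict (φ : A →A[ℂ] B) (M : LeftFrechetModule.{v, w} B) :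
    LeftFrechetModule.{u, w} A :=
  letI : Module A M.carrier := Module.compHom M.carrier (φ : A →+* B)
  { carrier := M.carrier
    isScalarTowerLeft := ⟨fun z a x => by
      change φ (z • a) • x = z • (φ a • x)
      rw [map_smul, smul_assoc]⟩
    continuousSMulLeft := ⟨by
      change Continuous fun p : A × M.carrier => φ p.1 • p.2
      exact (φ.continuous.comp continuous_fst).smul continuous_snd⟩ }

/-- Restriction of scalars along a continuous homomorphism `φ : A → B`: `x · a = x · φ a`. -/
def RightFrechetModule.restrict (φ : A →A[ℂ] B) (M : RightFrechetModule.{v, w} B) :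
    RightFrechetModule.{u, w} A :=
  letI : Module Aᵐᵒᵖ M.carrier := Module.compHom M.carrier (φ : A →+* B).op
  { carrier := M.carrier
    isScalarTowerRight := ⟨fun z a x => by
      change MulOpposite.op (φ (z • a.unop)) • x = z • (MulOpposite.op (φ a.unop) • x)
      rw [map_smul, MulOpposite.op_smul, smul_assoc]⟩
    continuousSMulRight := ⟨by
      change Continuous fun p : Aᵐᵒᵖ × M.carrier => MulOpposite.op (φ p.1.unop) • p.2
      exact (MulOpposite.continuous_op.comp (φ.continuous.comp
        (MulOpposite.continuous_unop.comp continuous_fst))).smul continuous_snd⟩ }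

/-- Restriction of scalars for bimodules: `a · x = φ a · x` and `x · a = x · φ a`. -/
def FrechetBimodule.restrict (φ : A →A[ℂ] B) (X : FrechetBimodule.{v, w} B) :
    FrechetBimodule.{u, w} A :=
  letI : Module A X.carrier := Module.compHom X.carrier (φ : A →+* B)
  letI : Module Aᵐᵒᵖ X.carrier := Module.compHom X.carrier (φ : A →+* B).op
  { carrier := X.carrier
    isScalarTowerLeft := (X.toLeftFrechetModule.restrict φ).isScalarTowerLeft
    continuousSMulLeft := (X.toLeftFrechetModule.restrict φ).continuousSMulLeft
    isScalarTowerRight := ⟨fun z a x => by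
      change MulOpposite.op (φ (z • a.unop)) • x = z • (MulOpposite.op (φ a.unop) • x)
      rw [map_smul, MulOpposite.op_smul, smul_assoc]⟩
    continuousSMulRight := ⟨by
      change Continuous fun p : Aᵐᵒᵖ × X.carrier => MulOpposite.op (φ p.1.unop) • p.2
      exact (MulOpposite.continuous_op.comp (φ.continuous.comp
        (MulOpposite.continuous_unop.comp continuous_fst))).smul continuous_snd⟩
    smulCommClass := ⟨fun a b x => by
      change φ a • (MulOpposite.op (φ b.unop) • x) = MulOpposite.op (φ b.unop) • (φ a • x)
      exact smul_comm _ _ _⟩ }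

/-- The one-dimensional bimodule `ℂ_ε` of a continuous character `ε : B → ℂ`:
`b · z = ε b * z` and `z · b = z * ε b`. -/
noncomputable def charBimodule (ε : B →A[ℂ] ℂ) : FrechetBimodule.{v, 0} B :=
  letI : Module B ℂ := Module.compHom ℂ (ε : B →+* ℂ)
  letI : Module Bᵐᵒᵖ ℂ := Module.compHom ℂ ((ε : B →+* ℂ).fromOpposite fun _ _ => mul_comm _ _)
  { carrier := ℂ
    isScalarTowerLeft := ⟨fun z b x => by
      change ε (z • b) * x = z * (ε b * x)
      rw [map_smul, smul_eq_mul, mul_assoc]⟩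
    continuousSMulLeft := ⟨by
      change Continuous fun p : B × ℂ => ε p.1 * p.2
      exact (ε.continuous.comp continuous_fst).mul continuous_snd⟩
    isScalarTowerRight := ⟨fun z b x => by
      change ε (z • b.unop) * x = z * (ε b.unop * x)
      rw [map_smul, smul_eq_mul, mul_assoc]⟩
    continuousSMulRight := ⟨by
      change Continuous fun p : Bᵐᵒᵖ × ℂ => ε p.1.unop * p.2
      exact (ε.continuous.comp (MulOpposite.continuous_unop.comp continuous_fst)).mul
        continuous_snd⟩
    smulCommClass := ⟨fun a b x => by
      change ε a * (ε b.unop * x) = ε b.unop * (ε a * x)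
      ring⟩ }

end Objects

/-- `φ` is an epimorphism in the category of Fréchet algebras and continuous (unital)
homomorphisms. -/
def IsFrechetEpi {A B : Type u} [Ring A] [Algebra ℂ A] [UniformSpace A]
    [Ring B] [Algebra ℂ B] [UniformSpace B] (φ : A →A[ℂ] B) : Prop :=
  ∀ (C : Type u) [Ring C] [Algebra ℂ C] [UniformSpace C] [FrechetAlgebra C]
    (ψ ψ' : B →A[ℂ] C), ψ.comp φ = ψ'.comp φ → ψ = ψ'

/-! ### Continuous derivations -/

/-- `Der(A, X)`: the continuous derivations `D : A → X`, i.e. the continuous linear maps with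
`D (a b) = a · D b + D a · b`. -/
def contDer (A : Type u) [Ring A] [Algebra ℂ A] [UniformSpace A] (X : FrechetBimodule.{u, v} A) :
    Submodule ℂ (A →L[ℂ] X.carrier) where
  carrier := {D | ∀ a b : A, D (a * b) = a • D b + MulOpposite.op b • D a}
  zero_mem' := fun a b => by simp
  add_mem' := fun {D E} hD hE a b => by
    simp only [add_apply, hD a b, hE a b, smul_add]
    abel
  smul_mem' := fun z D hD a b => by
    simp only [smul_apply, hD a b, smul_add]
    rw [smul_algebra_smul_comm, ← smul_algebra_smul_comm z (MulOpposite.op b)]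

/-- The linear map `Der(B, X) → Der(A, X)`, `D ↦ D ∘ φ`. -/
def derRestrict {A : Type u} [Ring A] [Algebra ℂ A] [UniformSpace A]
    {B : Type v} [Ring B] [Algebra ℂ B] [UniformSpace B]
    (φ : A →A[ℂ] B) (X : FrechetBimodule.{v, w} B) :
    contDer B X →ₗ[ℂ] contDer A (X.restrict φ) where
  toFun D := ⟨(show A →L[ℂ] X.carrier from D.1.comp φ.toContinuousLinearMap), fun a b => by
    change D.1 (φ (a * b)) = φ a • D.1 (φ b) + MulOpposite.op (φ b) • D.1 (φ a)
    rw [map_mul]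
    exact D.2 _ _⟩
  map_add' _ _ := rfl
  map_smul' _ _ := rfl

/-! ### The completed projective tensor product -/

section ProjectiveTensor

variable (E : Type u) [AddCommGroup E] [Module ℂ E] [UniformSpace E]
  (F : Type v) [AddCommGroup F] [Module ℂ F] [UniformSpace F]

/-- The algebraic tensor product over `ℂ`, to be given the projective topology. -/
def ProjTensor : Type max u v := E ⊗[ℂ] F

noncomputable instance : AddCommGroup (ProjTensor E F) := inferInstanceAs (AddCommGroup (E ⊗[ℂ] F))

noncomputable instance : Module ℂ (ProjTensor E F) := inferInstanceAs (Module ℂ (E ⊗[ℂ] F))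

/-- All seminorms `s` on `E ⊗ F` for which `(x, y) ↦ s (x ⊗ y)` is continuous. They define the
finest locally convex topology for which the canonical bilinear map is continuous. -/
def projSeminorms : SeminormFamily ℂ (ProjTensor E F)
    {s : Seminorm ℂ (ProjTensor E F) // Continuous fun p : E × F => s (p.1 ⊗ₜ[ℂ] p.2)} :=
  fun s => s.1

instance : Nonempty {s : Seminorm ℂ (ProjTensor E F) //
    Continuous fun p : E × F => s (p.1 ⊗ₜ[ℂ] p.2)} :=
  ⟨⟨0, continuous_const⟩⟩

/-- The projective topology. -/
noncomputable instance : TopologicalSpace (ProjTensor E F) :=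
  (projSeminorms E F).moduleFilterBasis.topology

theorem projTensor_withSeminorms : WithSeminorms (projSeminorms E F) := ⟨rfl⟩

instance : IsTopologicalAddGroup (ProjTensor E F) :=
  (projTensor_withSeminorms E F).topologicalAddGroup

instance : ContinuousSMul ℂ (ProjTensor E F) :=
  (projTensor_withSeminorms E F).continuousSMul

noncomputable instance : UniformSpace (ProjTensor E F) :=
  IsTopologicalAddGroup.rightUniformSpace (ProjTensor E F)

instance : IsUniformAddGroup (ProjTensor E F) := isUniformAddGroup_of_addCommGroup

instance : UniformContinuousConstSMul ℂ (ProjTensor E F) :=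
  uniformContinuousConstSMul_of_continuousConstSMul _ _

/-- The completed projective tensor product of `E` and `F`. -/
abbrev CompletedTensor : Type max u v := UniformSpace.Completion (ProjTensor E F)

variable {E F}

/-- The elementary tensor `x ⊗ y` in the completed projective tensor product. -/
noncomputable def completedTmul (x : E) (y : F) : CompletedTensor E F :=
  ((show ProjTensor E F from x ⊗ₜ[ℂ] y : ProjTensor E F) : CompletedTensor E F)

variable {F' : Type w} [AddCommGroup F'] [Module ℂ F'] [UniformSpace F']

variable (E) in
/-- `id ⊗ g` on algebraic tensor products, as a continuous map for the projective topologies. -/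
noncomputable def projTensorMap (g : F →L[ℂ] F') : ProjTensor E F →L[ℂ] ProjTensor E F' where
  toLinearMap := (LinearMap.lTensor E (g : F →ₗ[ℂ] F') : E ⊗[ℂ] F →ₗ[ℂ] E ⊗[ℂ] F')
  cont := by
    refine WithSeminorms.continuous_of_continuous_comp (projTensor_withSeminorms E F') _ fun s => ?_
    have h : Continuous fun p : E × F => s.1 (p.1 ⊗ₜ[ℂ] g p.2) :=
      s.2.comp (continuous_fst.prodMk (g.continuous.comp continuous_snd))
    exact (projTensor_withSeminorms E F).continuous_seminorm
      ⟨s.1.comp (LinearMap.lTensor E (g : F →ₗ[ℂ] F') : E ⊗[ℂ] F →ₗ[ℂ] E ⊗[ℂ] F'), h⟩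

variable (E) in
/-- `id ⊗ g` on completed projective tensor products. -/
noncomputable def completedTensorMap (g : F →L[ℂ] F') :
    CompletedTensor E F →L[ℂ] CompletedTensor E F' :=
  (projTensorMap E g).completion

theorem completedTensorMap_tmul (g : F →L[ℂ] F') (x : E) (y : F) :
    completedTensorMap E g (completedTmul x y) = completedTmul x (g y) := by
  change UniformSpace.Completion.map (projTensorMap E g) _ = _
  exact UniformSpace.Completion.map_coe (projTensorMap E g).uniformContinuous
    (show ProjTensor E F from x ⊗ₜ[ℂ] y)

end ProjectiveTensor

/-! ### The module tensor product, resolutions and transversality -/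

section Modules

variable {A : Type u} [Ring A] [Algebra ℂ A] [UniformSpace A]

/-- Morphisms of left Fréchet modules: continuous `A`-linear maps. -/
abbrev LeftFrechetModule.Hom (M : LeftFrechetModule.{u, v} A) (N : LeftFrechetModule.{u, w} A) :=
  M.carrier →L[A] N.carrier

/-- A morphism of left Fréchet modules as a continuous complex linear map. -/
def LeftFrechetModule.Hom.toComplex {M : LeftFrechetModule.{u, v} A}
    {N : LeftFrechetModule.{u, w} A} (g : M.Hom N) : M.carrier →L[ℂ] N.carrier :=
  ContinuousLinearMap.restrictScalars ℂ g

/-- The closed linear span of all `x · a ⊗ y - x ⊗ a · y`. -/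
noncomputable def balancedSubmodule (M : RightFrechetModule.{u, v} A)
    (N : LeftFrechetModule.{u, w} A) : Submodule ℂ (CompletedTensor M.carrier N.carrier) :=
  (Submodule.span ℂ {t | ∃ (x : M.carrier) (a : A) (y : N.carrier),
    t = completedTmul (MulOpposite.op a • x) y - completedTmul x (a • y)}).topologicalClosure

/-- The `A`-module tensor product of a right and a left Fréchet `A`-module: the quotient of the
completed projective tensor product by the closed span of all `x · a ⊗ y - x ⊗ a · y`. -/
abbrev ModuleTensor (M : RightFrechetModule.{u, v} A) (N : LeftFrechetModule.{u, w} A) :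
    Type max v w :=
  CompletedTensor M.carrier N.carrier ⧸ balancedSubmodule M N

theorem balancedSubmodule_le_comap (M : RightFrechetModule.{u, v} A)
    {N N' : LeftFrechetModule.{u, w} A} (g : N.Hom N') :
    balancedSubmodule M N ≤
      (balancedSubmodule M N').comap (completedTensorMap M.carrier g.toComplex).toLinearMap := by
  refine Submodule.topologicalClosure_minimal _ (Submodule.span_le.2 ?_) ?_
  · rintro _ ⟨x, a, y, rfl⟩
    refine Submodule.le_topologicalClosure _ (Submodule.subset_span ⟨x, a, g y, ?_⟩)
    change completedTensorMap M.carrier g.toComplex _ = _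
    rw [map_sub, completedTensorMap_tmul, completedTensorMap_tmul]
    congr 2
    exact map_smul g a y
  · exact (Submodule.isClosed_topologicalClosure _).preimage
      (completedTensorMap M.carrier g.toComplex).continuous

/-- `id ⊗ g` on `A`-module tensor products. -/
noncomputable def moduleTensorMap (M : RightFrechetModule.{u, v} A)
    {N N' : LeftFrechetModule.{u, w} A} (g : N.Hom N') :
    ModuleTensor M N →ₗ[ℂ] ModuleTensor M N' :=
  Submodule.mapQ _ _ (completedTensorMap M.carrier g.toComplex).toLinearMap
    (balancedSubmodule_le_comap M g)

/-- `0 ← Z ← Y ← X ← 0` is an admissible sequence of left Fréchet modules: a complex that has a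
contracting homotopy consisting of continuous `ℂ`-linear maps. -/
def IsAdmissibleShort {X Y Z : LeftFrechetModule.{u, v} A} (i : X.Hom Y) (p : Y.Hom Z) : Prop :=
  (∀ x, p (i x) = 0) ∧
  ∃ (r : Y.carrier →L[ℂ] X.carrier) (s : Z.carrier →L[ℂ] Y.carrier),
    (∀ x, r (i x) = x) ∧ (∀ y, i (r y) + s (p y) = y) ∧ (∀ z, p (s z) = z)

/-- A left Fréchet module `P` is projective if `Hom(P, -)` takes admissible sequences to exact
sequences. -/
def LeftFrechetModule.IsProjective (P : LeftFrechetModule.{u, v} A) : Prop :=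
  ∀ (X Y Z : LeftFrechetModule.{u, v} A) (i : X.Hom Y) (p : Y.Hom Z), IsAdmissibleShort i p →
    Function.Injective (fun f : P.Hom X => i.comp f) ∧
    Function.Exact (fun f : P.Hom X => i.comp f) (fun f : P.Hom Y => p.comp f) ∧
    Function.Surjective (fun f : P.Hom Y => p.comp f)

/-- A projective resolution `0 ← N ← Q₀ ← Q₁ ← ⋯` in the category of left Fréchet modules: the
`Qₙ` are projective and the augmented complex is admissible. -/
structure FrechetProjectiveResolution (N : LeftFrechetModule.{u, v} A) where
  Q : ℕ → LeftFrechetModule.{u, v} A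
  projective : ∀ n, (Q n).IsProjective
  d : ∀ n, (Q (n + 1)).Hom (Q n)
  η : (Q 0).Hom N
  η_d : ∀ x, η (d 0 x) = 0
  d_d : ∀ n x, d n (d (n + 1) x) = 0
  admissible : ∃ (s : N.carrier →L[ℂ] (Q 0).carrier)
    (h : ∀ n, (Q n).carrier →L[ℂ] (Q (n + 1)).carrier),
    (∀ y, η (s y) = y) ∧ (∀ x, d 0 (h 0 x) + s (η x) = x) ∧
    (∀ n x, d (n + 1) (h (n + 1) x) + h n (d n x) = x)

/-- `M` and `N` are `n`-transversal over `A`, `M ⊥ⁿ_A N`: for some projective resolution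
`0 ← N ← Q₀ ← Q₁ ← ⋯` the sequence `0 ← M ⊗_A N ← M ⊗_A Q₀ ← ⋯ ← M ⊗_A Q_{n+1}` is exact
(at every term but the last one). -/
def IsTransversal (n : ℕ) (M : RightFrechetModule.{u, v} A) (N : LeftFrechetModule.{u, w} A) :
    Prop :=
  ∃ R : FrechetProjectiveResolution N,
    Function.Surjective (moduleTensorMap M R.η) ∧
    Function.Exact (moduleTensorMap M (R.d 0)) (moduleTensorMap M R.η) ∧
    ∀ m < n, Function.Exact (moduleTensorMap M (R.d (m + 1))) (moduleTensorMap M (R.d m))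

end Modules

/-! ### The open mapping theorem for complete metrizable spaces -/

section OpenMapping

open Filter Topology

variable {E : Type u} [AddCommGroup E] [Module ℂ E] [UniformSpace E] [IsUniformAddGroup E]
  [ContinuousSMul ℂ E]
  {F : Type v} [AddCommGroup F] [Module ℂ F] [TopologicalSpace F] [IsTopologicalAddGroup F]
  [ContinuousSMul ℂ F]

/-! Write χ = ε ∘ φ.

Injectivity: if `D` vanishes on φ(A), then b ↦ (b, D b) and b ↦ (b, 0) are homomorphisms into a
square-zero extension of B that agree on φ(A), so the epimorphism property makes them equal
(`IsFrechetEpi.derivation_eq_zero`). Applied to the quotient of B by the closed left ideal J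
generated by all φ(a) - χ(a), with right action through ε, the same argument kills b ↦ b - ε(b) mod
J. Hence b ⊗ 1 = ε(b) (1 ⊗ 1) in B ⊗_A ℂ_ε.

Surjectivity: a derivation D of A at χ is an extension of ℂ_χ by itself. Lifting η : Q₀ → ℂ_χ
through it gives a functional l on Q₀ with l(a q) = χ(a) l(q) + D(a) η(q), and l ∘ d₀ is a cocycle
on Q₁. The functional F = ε ⊗ (l ∘ d₀) descends to B ⊗_A Q₁ and vanishes on the image of d₁, so
exactness there makes it vanish on ker d₀. Choose q with η(q) = 1. The tensor (b - ε(b)) ⊗ q dies in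
B ⊗_A ℂ_ε, so exactness at B ⊗_A Q₀ writes it as d₀ w, and D'(b) = F(w) is well defined. The
derivation rule comes from left multiplication by B, and D' ∘ φ = D from the contracting homotopy.
Continuity of D' is an open mapping argument for the closed relation {(w, b)}, which requires the
completed tensor product to be complete and metrizable
(`CompletedTensor.uniformity_isCountablyGenerated`). -/

theorem ContinuousLinearMap.closure_image_mem_nhds_zero_of_baire [BaireSpace F] (f : E →L[ℂ] F)
    (hf : Function.Surjective f) {U : Set E} (hU : U ∈ 𝓝 0) : closure (f '' U) ∈ 𝓝 0 := by
  obtain ⟨V, hV, hVU⟩ : ∃ V ∈ 𝓝 (0 : E), ∀ x ∈ V, ∀ y ∈ V, x - y ∈ U := by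
    have h : Tendsto (fun p : E × E => p.1 - p.2) (𝓝 0 ×ˢ 𝓝 0) (𝓝 0) := by
      have := (show Continuous fun p : E × E => p.1 - p.2 by fun_prop).tendsto (0, 0)
      rwa [nhds_prod_eq, sub_zero] at this
    obtain ⟨V, hV, h⟩ := mem_prod_same_iff.1 (h hU)
    exact ⟨V, hV, fun x hx y hy => h (Set.mk_mem_prod hx hy)⟩
  -- The dilates of the closure of f(V) cover F, so by Baire one of them has interior. Rescaling
  -- makes that closure a neighbourhood of some c, and subtracting c moves it to 0, at the cost of
  -- replacing V by V - V ⊆ U.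
  have hcover : ⋃ k : ℕ, (fun y : F => ((k : ℂ) + 1)⁻¹ • y) ⁻¹' closure (f '' V) = Set.univ := by
    refine Set.eq_univ_of_forall fun y => ?_
    obtain ⟨x, rfl⟩ := hf y
    have h0 : Tendsto (fun k : ℕ => ((k : ℂ) + 1)⁻¹ • x) atTop (𝓝 0) := by
      have h1 : Tendsto (fun k : ℕ => ((k : ℂ) + 1)⁻¹) atTop (𝓝 0) := by
        simpa using tendsto_one_div_add_atTop_nhds_zero_nat (𝕜 := ℂ)
      simpa using h1.smul_const x
    obtain ⟨k, hk⟩ := (h0.eventually hV).exists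
    exact Set.mem_iUnion.2 ⟨k, subset_closure ⟨_, hk, map_smul f _ _⟩⟩
  obtain ⟨k, y, hy⟩ := nonempty_interior_of_iUnion_of_closed
    (fun k : ℕ => isClosed_closure.preimage (continuous_const_smul ((k : ℂ) + 1)⁻¹)) hcover
  have hk : ((k : ℂ) + 1) ≠ 0 := by exact_mod_cast k.succ_ne_zero
  set c : F := ((k : ℂ) + 1)⁻¹ • y with hc
  have hcn : closure (f '' V) ∈ 𝓝 c := by
    have h1 : Tendsto (fun z : F => ((k : ℂ) + 1) • z) (𝓝 c) (𝓝 y) := by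
      have := (continuous_const_smul ((k : ℂ) + 1)).tendsto c
      rwa [hc, smul_inv_smul₀ hk] at this
    filter_upwards [h1 (mem_interior_iff_mem_nhds.1 hy)] with z hz
    simpa [inv_smul_smul₀ hk] using hz
  have h2 : Tendsto (fun z : F => c + z) (𝓝 0) (𝓝 c) := by
    simpa using (show Continuous fun z : F => c + z by fun_prop).tendsto 0
  filter_upwards [h2 hcn] with z hz
  have : c + z - c ∈ closure (f '' U) :=
    map_mem_closure₂ continuous_sub hz (mem_of_mem_nhds hcn) (by
      rintro _ ⟨x, hx, rfl⟩ _ ⟨x', hx', rfl⟩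
      exact ⟨x - x', hVU x hx x' hx', map_sub f x x'⟩)
  simpa using this

theorem ContinuousLinearMap.isOpenMap_of_complete_of_baire [CompleteSpace E]
    [FirstCountableTopology E] [BaireSpace F] [T2Space F] (f : E →L[ℂ] F)
    (hf : Function.Surjective f) : IsOpenMap f := by
  obtain ⟨u, hu, hadd⟩ := IsTopologicalAddGroup.exists_antitone_basis_nhds_zero E
  have hmem n : u n ∈ 𝓝 (0 : E) := hu.1.mem_of_mem trivial
  have hzero n : (0 : E) ∈ u n := mem_of_mem_nhds (hmem n)
  -- Successive approximation: y is corrected by f(x₀), f(x₁), … with xₖ ∈ u (n + 1 + k), the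
  -- remainders Yₖ staying in the closure of f(u (n + 1 + k)).
  have hsub n : closure (f '' u (n + 1)) ⊆ f '' closure (u n) := by
    intro y hy
    have hstep (k : ℕ) (z : {z : F // z ∈ closure (f '' u (n + 1 + k))}) :
        ∃ x ∈ u (n + 1 + k), (z : F) - f x ∈ closure (f '' u (n + 1 + (k + 1))) := by
      have h := f.closure_image_mem_nhds_zero_of_baire hf (hmem (n + 1 + (k + 1)))
      have ht : Tendsto (fun t : F => (z : F) - t) (𝓝 z) (𝓝 0) := by
        simpa using
          (show Continuous fun t : F => (z : F) - t by fun_prop).tendsto z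
      obtain ⟨_, ht, x, hx, rfl⟩ := mem_closure_iff_nhds.1 z.2 _ (ht h)
      exact ⟨x, hx, ht⟩
    choose g hg hg' using hstep
    let Y : ∀ k : ℕ, {z : F // z ∈ closure (f '' u (n + 1 + k))} :=
      fun k => Nat.rec ⟨y, hy⟩ (fun k z => ⟨(z : F) - f (g k z), hg' k z⟩) k
    let x : ℕ → E := fun k => g k (Y k)
    have hx k : x k ∈ u (n + 1 + k) := hg k _
    have hY (k : ℕ) : (Y (k + 1)).1 = (Y k).1 - f (x k) := rfl
    let S : ℕ → E := fun k => ∑ i ∈ Finset.range k, x i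
    have hS k : f (S k) = y - (Y k).1 := by
      induction k with
      | zero => simp [S, Y]
      | succ k ih =>
        simp only [S, Finset.sum_range_succ, map_add, hY] at ih ⊢
        rw [ih]; abel
    -- The sum telescopes from the tail because u (j + 1) + u (j + 1) ⊆ u j. This gives the Cauchy
    -- property, and k = 0 places all partial sums in u n.
    have hdiff m : ∀ k, S (k + m) - S k ∈ u (n + k) := by
      induction m with
      | zero => intro k; simpa using hzero (n + k)
      | succ m ih =>
        intro k
        have h1 : S (k + (m + 1)) - S k = x k + (S (k + 1 + m) - S (k + 1)) := by
          rw [show k + (m + 1) = k + 1 + m by ring]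
          simp only [S, Finset.sum_range_succ _ k]
          abel
        rw [h1]
        refine hadd _ (Set.add_mem_add ?_ ?_)
        · simpa [add_right_comm] using hx k
        · simpa [add_assoc] using ih (k + 1)
    have hC : CauchySeq S := by
      refine hu.1.uniformity_of_nhds_zero_swapped.cauchySeq_iff'.2 fun k _ => ⟨k, fun m hm => ?_⟩
      obtain ⟨j, rfl⟩ := Nat.exists_eq_add_of_le hm
      exact hu.2 (Nat.le_add_left k n) (hdiff j k)
    obtain ⟨a, ha⟩ := cauchySeq_tendsto_of_complete hC
    refine ⟨a, mem_closure_of_tendsto ha (Eventually.of_forall fun k => ?_), ?_⟩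
    · simpa [S] using hdiff k 0
    have hY0 : Tendsto (fun k => (Y k).1) atTop (𝓝 0) := by
      refine ((closed_nhds_basis (0 : F)).tendsto_right_iff).2 fun N hN => ?_
      have h1 : f ⁻¹' N ∈ 𝓝 (0 : E) := f.continuous.continuousAt (by simpa using hN.1)
      obtain ⟨k, -, hk⟩ := hu.1.mem_iff.1 h1
      filter_upwards [eventually_ge_atTop k] with m hm
      exact closure_minimal (Set.image_subset_iff.2 ((hu.2 (by omega)).trans hk)) hN.2 (Y m).2
    have h2 : Tendsto (fun k => f (S k)) atTop (𝓝 y) := by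
      simp only [hS]
      simpa using hY0.const_sub y
    exact tendsto_nhds_unique ((f.continuous.tendsto a).comp ha) h2
  rw [IsTopologicalAddGroup.isOpenMap_iff_nhds_zero]
  intro U hU
  obtain ⟨C, ⟨hC, hCc⟩, hCU⟩ := (closed_nhds_basis (0 : E)).mem_iff.1 (mem_map.1 hU)
  obtain ⟨k, -, hk⟩ := hu.1.mem_iff.1 hC
  refine mem_of_superset (f.closure_image_mem_nhds_zero_of_baire hf (hmem (k + 1))) ?_
  exact (hsub k).trans (Set.image_subset_iff.2 ((closure_minimal hk hCc).trans hCU))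

end OpenMapping

/-! ### Metrizability and universal property of the completed projective tensor product -/

section ProjectiveTensorMetrizable

open Filter Topology

/-- Joint continuity at (0, 0) passes to closures inside a closed neighbourhood. For a fixed m,
split c • m = c • (m - x) + c • x with x in the dense subspace and m - x small. -/
theorem UniformSpace.Completion.continuousSMul (E : Type u) [AddCommGroup E] [Module ℂ E]
    [UniformSpace E] [IsUniformAddGroup E] [UniformContinuousConstSMul ℂ E] [ContinuousSMul ℂ E] :
    ContinuousSMul ℂ (UniformSpace.Completion E) := by
  have hmul : Tendsto (fun p : ℂ × UniformSpace.Completion E => p.1 • p.2) (𝓝 0 ×ˢ 𝓝 0)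
      (𝓝 0) := by
    refine (closed_nhds_basis (0 : UniformSpace.Completion E)).tendsto_right_iff.2 fun N hN => ?_
    have h1 : Tendsto (fun p : ℂ × E => ((p.1 • p.2 : E) : UniformSpace.Completion E))
        (𝓝 0 ×ˢ 𝓝 0) (𝓝 0) := by
      rw [← nhds_prod_eq]
      exact ((UniformSpace.Completion.continuous_coe E).comp continuous_smul).tendsto' _ _
        (by simp [UniformSpace.Completion.coe_zero])
    obtain ⟨S, hS, U, hU, hSU⟩ := mem_prod_iff.1 (h1 hN.1)
    have hU' : closure ((↑) '' U) ∈ 𝓝 (0 : UniformSpace.Completion E) :=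
      UniformSpace.Completion.coe_zero (α := E) ▸
        UniformSpace.Completion.isDenseInducing_coe.closure_image_mem_nhds hU
    filter_upwards [prod_mem_prod hS hU'] with p hp
    refine closure_minimal ?_ hN.2
      (image_closure_subset_closure_image (continuous_const_smul p.1) ⟨p.2, hp.2, rfl⟩)
    rintro _ ⟨_, ⟨x, hx, rfl⟩, rfl⟩
    change p.1 • (x : UniformSpace.Completion E) ∈ N
    rw [← UniformSpace.Completion.coe_smul]
    exact hSU (Set.mk_mem_prod hp.1 hx)
  refine ContinuousSMul.of_nhds_zero hmul (fun m => ?_)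
    fun a => (continuous_const_smul a).tendsto' _ _ (smul_zero a)
  intro W hW
  obtain ⟨N, hN, hNW⟩ := exists_nhds_zero_half hW
  obtain ⟨S, hS, V, hV, hSV⟩ := mem_prod_iff.1 (hmul hN)
  have hm : Tendsto (fun t => m - t) (𝓝 m) (𝓝 0) :=
    (show Continuous fun t => m - t by fun_prop).tendsto' _ _ (sub_self m)
  obtain ⟨_, hx, x, rfl⟩ := mem_closure_iff_nhds.1
    (UniformSpace.Completion.denseRange_coe (α := E) m) _ (hm hV)
  have hc : Tendsto (fun c : ℂ => ((c • x : E) : UniformSpace.Completion E)) (𝓝 0) (𝓝 0) :=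
    ((UniformSpace.Completion.continuous_coe E).comp
      (show Continuous fun c : ℂ => c • x by fun_prop)).tendsto' _ _
        (by simp [UniformSpace.Completion.coe_zero])
  change ∀ᶠ c in 𝓝 (0 : ℂ), c • m ∈ W
  filter_upwards [hS, hc.eventually_mem hN] with c hcS hcN
  have h := hNW _ (hSV (Set.mk_mem_prod hcS hx)) _ hcN
  rwa [UniformSpace.Completion.coe_smul, ← smul_add, sub_add_cancel] at h

theorem exists_smul_mem_of_mem_nhds_zero {E : Type*} [AddCommGroup E] [Module ℂ E]
    [TopologicalSpace E] [ContinuousSMul ℂ E] {U : Set E} (hU : U ∈ 𝓝 0) (x : E) :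
    ∃ c : ℂ, c ≠ 0 ∧ c • x ∈ U := by
  have h : Tendsto (fun c : ℂ => c • x) (𝓝[≠] 0) (𝓝 0) := by
    simpa using ((show Continuous fun c : ℂ => c • x by fun_prop).tendsto 0).mono_left
      nhdsWithin_le_nhds
  obtain ⟨c, hc, hc0⟩ := ((h.eventually hU).and self_mem_nhdsWithin).exists
  exact ⟨c, hc0, hc⟩

/-! ### Seminorms on tensors bounded on products of neighbourhoods -/

section Seminorm

variable {E : Type u} [AddCommGroup E] [Module ℂ E] [TopologicalSpace E] [ContinuousSMul ℂ E]
  {F : Type v} [AddCommGroup F] [Module ℂ F] [TopologicalSpace F] [ContinuousSMul ℂ F]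

/-- The seminorms on `E ⊗ F` that are at most one on `x ⊗ y` for `x ∈ U` and `y ∈ V`. -/
def tensorSeminormsLeOne (U : Set E) (V : Set F) : Set (Seminorm ℂ (E ⊗[ℂ] F)) :=
  {s | ∀ x ∈ U, ∀ y ∈ V, s (x ⊗ₜ y) ≤ 1}

/-- Neighbourhoods of 0 are absorbing, so the bound on U × V controls each elementary tensor and
hence each finite sum. Boundedness makes `sSup` the pointwise supremum instead of its default value
0. -/
theorem bddAbove_tensorSeminormsLeOne {U : Set E} (hU : U ∈ 𝓝 0) {V : Set F} (hV : V ∈ 𝓝 0) :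
    BddAbove (tensorSeminormsLeOne U V) := by
  rw [Seminorm.bddAbove_iff]
  suffices h : ∀ t : E ⊗[ℂ] F, ∃ C : ℝ, ∀ s ∈ tensorSeminormsLeOne U V, s t ≤ C by
    choose C hC using h
    refine ⟨C, ?_⟩
    rintro _ ⟨s, hs, rfl⟩ t
    exact hC t s hs
  intro t
  induction t with
  | zero => exact ⟨0, fun s _ => (map_zero s).le⟩
  | add a b ha hb =>
    obtain ⟨C, hC⟩ := ha
    obtain ⟨C', hC'⟩ := hb
    exact ⟨C + C', fun s hs => (map_add_le_add s a b).trans (add_le_add (hC s hs) (hC' s hs))⟩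
  | tmul x y =>
    obtain ⟨c, hc, hx⟩ := exists_smul_mem_of_mem_nhds_zero hU x
    obtain ⟨d, hd, hy⟩ := exists_smul_mem_of_mem_nhds_zero hV y
    refine ⟨(‖c * d‖)⁻¹, fun s hs => ?_⟩
    have h := hs _ hx _ hy
    rw [TensorProduct.smul_tmul_smul, map_smul_eq_mul] at h
    rwa [← one_div, le_div_iff₀' (norm_pos_iff.2 (mul_ne_zero hc hd))]

/-- Homogeneity turns the bound into separate continuity and joint continuity at the origin;
expanding x' ⊗ y' - x ⊗ y around (x, y) combines the two. -/
theorem continuous_tensorSeminorm_of_le_one [IsTopologicalAddGroup E]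
    [IsTopologicalAddGroup F] {U : Set E} (hU : U ∈ 𝓝 0) {V : Set F} (hV : V ∈ 𝓝 0)
    {s : Seminorm ℂ (E ⊗[ℂ] F)} (hs : s ∈ tensorSeminormsLeOne U V) :
    Continuous fun p : E × F => s (p.1 ⊗ₜ[ℂ] p.2) := by
  have hr (x : E) : Continuous fun y : F => s (x ⊗ₜ[ℂ] y) := by
    obtain ⟨c, hc, hx⟩ := exists_smul_mem_of_mem_nhds_zero hU x
    refine Seminorm.continuous (p := s.comp (TensorProduct.mk ℂ E F x)) (r := ‖c‖⁻¹ + 1) ?_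
    filter_upwards [hV] with y hy
    have h := hs _ hx _ hy
    rw [← TensorProduct.smul_tmul', map_smul_eq_mul, ← le_inv_mul_iff₀ (norm_pos_iff.2 hc)] at h
    rw [Seminorm.mem_ball_zero, Seminorm.comp_apply, TensorProduct.mk_apply]
    linarith
  have hl (y : F) : Continuous fun x : E => s (x ⊗ₜ[ℂ] y) := by
    obtain ⟨c, hc, hy⟩ := exists_smul_mem_of_mem_nhds_zero hV y
    refine Seminorm.continuous (p := s.comp ((TensorProduct.mk ℂ E F).flip y)) (r := ‖c‖⁻¹ + 1) ?_
    filter_upwards [hU] with x hx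
    have h := hs _ hx _ hy
    rw [TensorProduct.tmul_smul, map_smul_eq_mul, ← le_inv_mul_iff₀ (norm_pos_iff.2 hc)] at h
    rw [Seminorm.mem_ball_zero, Seminorm.comp_apply, LinearMap.flip_apply, TensorProduct.mk_apply]
    linarith
  have h0 : Tendsto (fun p : E × F => s (p.1 ⊗ₜ[ℂ] p.2)) (𝓝 (0, 0)) (𝓝 0) := by
    rw [Metric.tendsto_nhds]
    intro ε hε
    have hc : ((ε / 2 : ℝ) : ℂ) ≠ 0 := by exact_mod_cast (half_pos hε).ne'
    have hV' : ∀ᶠ y in 𝓝 (0 : F), ((ε / 2 : ℝ) : ℂ)⁻¹ • y ∈ V :=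
      (continuous_const_smul ((ε / 2 : ℝ) : ℂ)⁻¹).tendsto' 0 0 (smul_zero _) hV
    rw [nhds_prod_eq]
    filter_upwards [prod_mem_prod hU hV'] with p hp
    have h := hs _ hp.1 _ hp.2
    rw [TensorProduct.tmul_smul, map_smul_eq_mul, norm_inv, Complex.norm_real, Real.norm_eq_abs,
      abs_of_pos (half_pos hε), inv_mul_le_iff₀ (half_pos hε)] at h
    rw [Real.dist_0_eq_abs, abs_of_nonneg (apply_nonneg s _)]
    linarith
  refine continuous_iff_continuousAt.2 fun ⟨x, y⟩ => ?_
  have h1 : Tendsto (fun p : E × F => s ((p.1 - x) ⊗ₜ[ℂ] (p.2 - y)) + s ((p.1 - x) ⊗ₜ[ℂ] y) +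
      s (x ⊗ₜ[ℂ] (p.2 - y))) (𝓝 (x, y)) (𝓝 0) := by
    have hx : Tendsto (fun p : E × F => p.1 - x) (𝓝 (x, y)) (𝓝 0) :=
      (show Continuous fun p : E × F => p.1 - x by fun_prop).tendsto' _ _ (sub_self x)
    have hy : Tendsto (fun p : E × F => p.2 - y) (𝓝 (x, y)) (𝓝 0) :=
      (show Continuous fun p : E × F => p.2 - y by fun_prop).tendsto' _ _ (sub_self y)
    have e1 := h0.comp (hx.prodMk_nhds hy)
    have e2 := ((hl y).tendsto' 0 0 (by simp)).comp hx
    have e3 := ((hr x).tendsto' 0 0 (by simp)).comp hy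
    simpa using (e1.add e2).add e3
  rw [ContinuousAt, tendsto_iff_dist_tendsto_zero]
  refine squeeze_zero (fun _ => dist_nonneg) (fun p => ?_) h1
  have h2 : p.1 ⊗ₜ[ℂ] p.2 - x ⊗ₜ[ℂ] y =
      (p.1 - x) ⊗ₜ[ℂ] (p.2 - y) + (p.1 - x) ⊗ₜ[ℂ] y + x ⊗ₜ[ℂ] (p.2 - y) := by
    simp only [TensorProduct.sub_tmul, TensorProduct.tmul_sub]; abel
  calc dist (s (p.1 ⊗ₜ[ℂ] p.2)) (s (x ⊗ₜ[ℂ] y)) ≤ s (p.1 ⊗ₜ[ℂ] p.2 - x ⊗ₜ[ℂ] y) := by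
        rw [Real.dist_eq]; exact abs_sub_map_le_sub s _ _
    _ ≤ _ := by
        rw [h2]
        exact (map_add_le_add s _ _).trans (add_le_add_left (map_add_le_add s _ _) _)

end Seminorm

variable (E : Type u) [AddCommGroup E] [Module ℂ E] [UniformSpace E] [FrechetSpace E]
  (F : Type v) [AddCommGroup F] [Module ℂ F] [UniformSpace F] [FrechetSpace F]

theorem FrechetSpace.firstCountableTopology : FirstCountableTopology E :=
  have := FrechetSpace.countablyGenerated (E := E)
  UniformSpace.firstCountableTopology E

/-- For bases uₙ, vₙ at 0, the largest seminorms that are at most 1 on uₙ × vₙ suffice: each is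
admissible, and every admissible seminorm is at most 1 on some uₙ × vₙ, hence dominated by the n-th
one. -/
theorem ProjTensor.firstCountableTopology : FirstCountableTopology (ProjTensor E F) := by
  have := FrechetSpace.firstCountableTopology E
  have := FrechetSpace.firstCountableTopology F
  obtain ⟨u, hu⟩ := (𝓝 (0 : E)).exists_antitone_basis
  obtain ⟨v, hv⟩ := (𝓝 (0 : F)).exists_antitone_basis
  have hun n : u n ∈ 𝓝 (0 : E) := hu.1.mem_of_mem trivial
  have hvn n : v n ∈ 𝓝 (0 : F) := hv.1.mem_of_mem trivial
  have hb n := bddAbove_tensorSeminormsLeOne (hun n) (hvn n)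
  let q : SeminormFamily ℂ (ProjTensor E F) ℕ := fun n => sSup (tensorSeminormsLeOne (u n) (v n))
  have hne (n : ℕ) : (0 : Seminorm ℂ (E ⊗[ℂ] F)) ∈ tensorSeminormsLeOne (u n) (v n) :=
    fun _ _ _ _ => zero_le_one
  have hq (n : ℕ) : sSup (tensorSeminormsLeOne (u n) (v n)) ∈ tensorSeminormsLeOne (u n) (v n) := by
    intro x hx y hy
    rw [Seminorm.sSup_apply (hb n)]
    have : Nonempty (tensorSeminormsLeOne (u n) (v n)) := ⟨⟨0, hne n⟩⟩
    exact ciSup_le fun s => s.2 x hx y hy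
  have hW : WithSeminorms q := by
    refine (projTensor_withSeminorms E F).congr (fun n => ?_) (fun s => ?_)
    · refine ⟨{⟨q n, continuous_tensorSeminorm_of_le_one (hun n) (hvn n) (hq n)⟩}, 1, ?_⟩
      rw [Finset.sup_singleton, one_smul]
      exact le_rfl
    · have h0 : Tendsto (fun p : E × F => s.1 (p.1 ⊗ₜ[ℂ] p.2)) (𝓝 0 ×ˢ 𝓝 0) (𝓝 0) := by
        rw [← nhds_prod_eq]
        exact s.2.tendsto' _ _ (by rw [TensorProduct.zero_tmul]; exact map_zero s.1)
      obtain ⟨n, -, hn⟩ := (hu.prod hv).1.mem_iff.1 (h0 (Iio_mem_nhds one_pos))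
      refine ⟨{n}, 1, ?_⟩
      rw [Finset.sup_singleton, one_smul]
      exact le_csSup (hb n) fun x hx y hy => (hn (Set.mk_mem_prod hx hy)).le
  exact hW.firstCountableTopology

theorem CompletedTensor.uniformity_isCountablyGenerated :
    (uniformity (CompletedTensor E F)).IsCountablyGenerated := by
  have := ProjTensor.firstCountableTopology E F
  have : (𝓝 (0 : CompletedTensor E F)).IsCountablyGenerated := by
    obtain ⟨u, hu⟩ := (𝓝 (0 : ProjTensor E F)).exists_antitone_basis
    have := hu.1.hasBasis_of_isDenseInducing UniformSpace.Completion.isDenseInducing_coe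
    rw [UniformSpace.Completion.coe_zero] at this
    exact this.isCountablyGenerated
  exact IsUniformAddGroup.uniformity_countably_generated

end ProjectiveTensorMetrizable

/-! ### Maps and functionals on the completed tensor product -/

section ProjectiveTensorMaps

variable {E : Type u} [AddCommGroup E] [Module ℂ E] [UniformSpace E]
  {F : Type v} [AddCommGroup F] [Module ℂ F] [UniformSpace F]

variable (E F) in
/-- The canonical map from the algebraic to the completed projective tensor product. -/
noncomputable def ProjTensor.toCompleted : ProjTensor E F →L[ℂ] CompletedTensor E F where
  toFun t := (t : CompletedTensor E F)
  map_add' := UniformSpace.Completion.coe_add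
  map_smul' := UniformSpace.Completion.coe_smul
  cont := UniformSpace.Completion.continuous_coe _

theorem CompletedTensor.ext {G : Type w} [AddCommGroup G] [Module ℂ G] [TopologicalSpace G]
    [T2Space G] {f g : CompletedTensor E F →L[ℂ] G}
    (h : ∀ x y, f (completedTmul x y) = g (completedTmul x y)) : f = g := by
  let f' : E ⊗[ℂ] F →ₗ[ℂ] G := (f.comp (ProjTensor.toCompleted E F)).toLinearMap
  let g' : E ⊗[ℂ] F →ₗ[ℂ] G := (g.comp (ProjTensor.toCompleted E F)).toLinearMap
  have h' : f' = g' := TensorProduct.ext' h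
  ext t
  induction t using UniformSpace.Completion.induction_on with
  | hp => exact isClosed_eq f.continuous g.continuous
  | ih t => exact LinearMap.congr_fun h' t

/-- `x ↦ x ⊗ y` as a continuous linear map. -/
noncomputable def completedTmulLeft [IsTopologicalAddGroup E] (y : F) : E →L[ℂ] CompletedTensor E F :=
  (ProjTensor.toCompleted E F).comp
    { toLinearMap := ((TensorProduct.mk ℂ E F).flip y : E →ₗ[ℂ] E ⊗[ℂ] F)
      cont := by
        refine WithSeminorms.continuous_of_continuous_comp (projTensor_withSeminorms E F) _
          fun s => ?_
        exact s.2.comp (continuous_id.prodMk continuous_const) }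

theorem completedTmulLeft_apply [IsTopologicalAddGroup E] (x : E) (y : F) : completedTmulLeft y x = completedTmul x y := rfl

theorem completedTmul_sub (x : E) (y y' : F) :
    completedTmul x (y - y') = completedTmul x y - completedTmul x y' := by
  have : (show ProjTensor E F from x ⊗ₜ[ℂ] (y - y')) =
      (show ProjTensor E F from x ⊗ₜ[ℂ] y) - (show ProjTensor E F from x ⊗ₜ[ℂ] y') :=
    TensorProduct.tmul_sub x y y'
  exact (congrArg _ this).trans (UniformSpace.Completion.coe_sub _ _)

theorem completedTmul_smul (x : E) (c : ℂ) (y : F) :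
    completedTmul x (c • y) = c • completedTmul x y := by
  have : (show ProjTensor E F from x ⊗ₜ[ℂ] (c • y)) = c • (show ProjTensor E F from x ⊗ₜ[ℂ] y) :=
    TensorProduct.tmul_smul c x y
  exact (congrArg _ this).trans (UniformSpace.Completion.coe_smul _ _)

variable (F) in
/-- `g ⊗ id` on completed projective tensor products. -/
noncomputable def completedTensorMapLeft (g : E →L[ℂ] E) :
    CompletedTensor E F →L[ℂ] CompletedTensor E F :=
  ContinuousLinearMap.completion
    { toLinearMap := (LinearMap.rTensor F (g : E →ₗ[ℂ] E) : E ⊗[ℂ] F →ₗ[ℂ] E ⊗[ℂ] F)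
      cont := by
        refine WithSeminorms.continuous_of_continuous_comp (projTensor_withSeminorms E F) _
          fun s => ?_
        exact (projTensor_withSeminorms E F).continuous_seminorm
          ⟨s.1.comp (LinearMap.rTensor F (g : E →ₗ[ℂ] E) : E ⊗[ℂ] F →ₗ[ℂ] E ⊗[ℂ] F),
            s.2.comp ((g.continuous.comp continuous_fst).prodMk continuous_snd)⟩ :
      ProjTensor E F →L[ℂ] ProjTensor E F }

theorem completedTensorMapLeft_tmul (g : E →L[ℂ] E) (x : E) (y : F) :
    completedTensorMapLeft F g (completedTmul x y) = completedTmul (g x) y := by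
  refine (UniformSpace.Completion.map_coe (ContinuousLinearMap.uniformContinuous _)
    (show ProjTensor E F from x ⊗ₜ[ℂ] y)).trans ?_
  rfl

/-- The functional `x ⊗ y ↦ f x * g y` on the projective tensor product. -/
noncomputable def projTensorFunctional (f : E →L[ℂ] ℂ) (g : F →L[ℂ] ℂ) : ProjTensor E F →L[ℂ] ℂ where
  toLinearMap := (LinearMap.mul' ℂ ℂ ∘ₗ TensorProduct.map (f : E →ₗ[ℂ] ℂ) (g : F →ₗ[ℂ] ℂ) :
    E ⊗[ℂ] F →ₗ[ℂ] ℂ)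
  cont := by
    refine WithSeminorms.continuous_of_continuous_comp (norm_withSeminorms ℂ ℂ) _ fun _ => ?_
    exact (projTensor_withSeminorms E F).continuous_seminorm
      ⟨(normSeminorm ℂ ℂ).comp (LinearMap.mul' ℂ ℂ ∘ₗ
        TensorProduct.map (f : E →ₗ[ℂ] ℂ) (g : F →ₗ[ℂ] ℂ) : E ⊗[ℂ] F →ₗ[ℂ] ℂ),
        ((f.continuous.comp continuous_fst).mul (g.continuous.comp continuous_snd)).norm⟩

/-- The functional `x ⊗ y ↦ f x * g y` on the completed projective tensor product. -/
noncomputable def completedTensorFunctional (f : E →L[ℂ] ℂ) (g : F →L[ℂ] ℂ) :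
    CompletedTensor E F →L[ℂ] ℂ :=
  (projTensorFunctional f g).extend
    (ProjTensor.toCompleted E F)

theorem completedTensorFunctional_tmul (f : E →L[ℂ] ℂ) (g : F →L[ℂ] ℂ) (x : E) (y : F) :
    completedTensorFunctional f g (completedTmul x y) = f x * g y :=
  ContinuousLinearMap.extend_eq (e := ProjTensor.toCompleted E F)
    (projTensorFunctional f g) UniformSpace.Completion.denseRange_coe
    (UniformSpace.Completion.isUniformInducing_coe _) (show ProjTensor E F from x ⊗ₜ[ℂ] y)

end ProjectiveTensorMaps

/-! ### Square-zero extensions and epimorphisms of Fréchet algebras -/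

section SquareZero

open Filter Topology

variable {A : Type u} [Ring A] [Algebra ℂ A] [UniformSpace A] [FrechetAlgebra A]

instance (E : Type u) (F : Type v) [AddCommGroup E] [Module ℂ E] [UniformSpace E] [FrechetSpace E]
    [AddCommGroup F] [Module ℂ F] [UniformSpace F] [FrechetSpace F] : FrechetSpace (E × F) where
  toLocallyConvexSpace := inferInstance
  countablyGenerated :=
    haveI := FrechetSpace.countablyGenerated (E := E)
    haveI := FrechetSpace.countablyGenerated (E := F)
    inferInstance

instance (M : Type v) [AddCommGroup M] [Module ℂ M] [UniformSpace M] [FrechetSpace M]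
    [Module A M] [Module Aᵐᵒᵖ M] [SMulCommClass A Aᵐᵒᵖ M] [IsScalarTower ℂ A M]
    [IsScalarTower ℂ Aᵐᵒᵖ M] [ContinuousSMul A M] [ContinuousSMul Aᵐᵒᵖ M] :
    FrechetAlgebra (TrivSqZeroExt A M) where
  toFrechetSpace := inferInstanceAs (FrechetSpace (A × M))
  toContinuousMul := inferInstance

/-- A continuous derivation gives a continuous homomorphism into the square-zero extension. -/
def squareZeroHom {M : Type v} [AddCommGroup M] [Module ℂ M] [UniformSpace M]
    [FrechetSpace M] [Module A M] [Module Aᵐᵒᵖ M] [SMulCommClass A Aᵐᵒᵖ M] [IsScalarTower ℂ A M]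
    [IsScalarTower ℂ Aᵐᵒᵖ M] (D : A →L[ℂ] M)
    (hD : ∀ a b, D (a * b) = a • D b + MulOpposite.op b • D a) : A →A[ℂ] TrivSqZeroExt A M where
  toAlgHom := AlgHom.ofLinearMap
    { toFun := fun a => TrivSqZeroExt.inl a + TrivSqZeroExt.inr (D a)
      map_add' := fun a b => by ext <;> simp
      map_smul' := fun c a => by ext <;> simp }
    (by
      have h := hD 1 1
      simp only [mul_one, one_smul, MulOpposite.op_one, left_eq_add] at h
      ext <;> simp [h])
    (fun a b => by ext <;> simp [hD])
  cont := by
    change Continuous fun a => TrivSqZeroExt.inl a + TrivSqZeroExt.inr (D a)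
    exact (TrivSqZeroExt.continuous_inl).add (TrivSqZeroExt.continuous_inr.comp D.continuous)

/-- The universe levels place the square-zero extension of B by M in the universe of B, where the
epimorphism property is tested. -/
theorem IsFrechetEpi.derivation_eq_zero {A B : Type (max u v)} [Ring A] [Algebra ℂ A] [UniformSpace A]
    [Ring B] [Algebra ℂ B] [UniformSpace B] [FrechetAlgebra B] {φ : A →A[ℂ] B} (hφ : IsFrechetEpi φ)
    {M : Type v} [AddCommGroup M] [Module ℂ M] [UniformSpace M] [FrechetSpace M]
    [Module B M] [Module Bᵐᵒᵖ M] [SMulCommClass B Bᵐᵒᵖ M] [IsScalarTower ℂ B M]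
    [IsScalarTower ℂ Bᵐᵒᵖ M] [ContinuousSMul B M] [ContinuousSMul Bᵐᵒᵖ M] (D : B →L[ℂ] M)
    (hD : ∀ a b, D (a * b) = a • D b + MulOpposite.op b • D a) (h0 : ∀ a, D (φ a) = 0) (b : B) :
    D b = 0 := by
  have h := hφ (TrivSqZeroExt B M) (squareZeroHom D hD) (squareZeroHom 0 fun a b => by simp) (by
    ext a : 1
    change TrivSqZeroExt.inl (φ a) + TrivSqZeroExt.inr (D (φ a)) =
      TrivSqZeroExt.inl (φ a) + TrivSqZeroExt.inr ((0 : B →L[ℂ] M) (φ a))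
    rw [h0, zero_apply])
  have := congrArg (fun f : B →A[ℂ] TrivSqZeroExt B M => (f b).snd) h
  change (TrivSqZeroExt.inl b + TrivSqZeroExt.inr (D b)).snd =
    (TrivSqZeroExt.inl b + TrivSqZeroExt.inr ((0 : B →L[ℂ] M) b)).snd at this
  simpa using this

variable {B : Type u} [Ring B] [Algebra ℂ B] [UniformSpace B] [FrechetAlgebra B]

/-- The quotient of a Fréchet algebra by a closed left ideal is a Fréchet space. -/
theorem FrechetSpace.quotient_leftIdeal (J : Submodule B B) (hJ : IsClosed (J : Set B)) :
    letI : UniformSpace (B ⧸ J) := IsTopologicalAddGroup.rightUniformSpace (B ⧸ J)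
    FrechetSpace (B ⧸ J) := by
  let _ : UniformSpace (B ⧸ J) := IsTopologicalAddGroup.rightUniformSpace (B ⧸ J)
  have : IsUniformAddGroup (B ⧸ J) := isUniformAddGroup_of_addCommGroup
  have := FrechetSpace.firstCountableTopology B
  have : CompleteSpace (B ⧸ J) := QuotientAddGroup.completeSpace_right B J.toAddSubgroup
  have : ContinuousSMul ℂ (B ⧸ J) := ⟨by
    -- Complex scalars act through B, whose action on the quotient is already continuous.
    have h : (fun p : ℂ × (B ⧸ J) => p.1 • p.2) = fun p => algebraMap ℂ B p.1 • p.2 := by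
      ext p
      exact (algebraMap_smul B p.1 p.2).symm
    rw [h]
    exact ((continuous_algebraMap ℂ B).comp continuous_fst).smul continuous_snd⟩
  have hlc : LocallyConvexSpace ℝ (B ⧸ J) := by
    refine (locallyConvexSpace_iff_exists_convex_subset_zero ℝ (B ⧸ J)).2 fun U hU => ?_
    have hU' : J.mkQ ⁻¹' U ∈ 𝓝 (0 : B) :=
      J.continuous_mkQ.tendsto' 0 0 (map_zero _) hU
    obtain ⟨S, hS, hSc, hSU⟩ :=
      (locallyConvexSpace_iff_exists_convex_subset_zero ℝ B).1 inferInstance _ hU'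
    refine ⟨J.mkQ '' S, ?_, ?_, Set.image_subset_iff.2 hSU⟩
    · simpa using J.isOpenMap_mkQ.image_mem_nhds hS
    · exact hSc.linear_image ((J.mkQ.restrictScalars ℂ).restrictScalars ℝ)
  have hcg : (uniformity (B ⧸ J)).IsCountablyGenerated := by
    have : (𝓝 (0 : B ⧸ J)).IsCountablyGenerated := by
      have h : 𝓝 (0 : B ⧸ J) = map J.mkQ (𝓝 0) :=
        (map_zero J.mkQ ▸ J.isOpenMap_mkQ.map_nhds_eq J.continuous_mkQ.continuousAt).symm
      rw [h]
      infer_instance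
    exact IsUniformAddGroup.uniformity_countably_generated
  have : IsClosed (J : Set B) := hJ
  exact { toLocallyConvexSpace := hlc, countablyGenerated := hcg }

/-- The closed left ideal generated by all `b φ(a) - ε(φ(a)) b`. -/
def augmentationIdeal (φ : A →A[ℂ] B) (ε : B →A[ℂ] ℂ) : Submodule B B :=
  (Submodule.span B {t | ∃ a, t = φ a - algebraMap ℂ B (ε (φ a))}).topologicalClosure

theorem IsFrechetEpi.sub_mem_augmentationIdeal {A : Type u} [Ring A] [Algebra ℂ A]
    [UniformSpace A] {φ : A →A[ℂ] B} (hφ : IsFrechetEpi φ)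
    (ε : B →A[ℂ] ℂ) (b : B) : b - algebraMap ℂ B (ε b) ∈ augmentationIdeal φ ε := by
  set J := augmentationIdeal φ ε with hJ
  have hJc : IsClosed (J : Set B) := Submodule.isClosed_topologicalClosure _
  let Q := B ⧸ J
  let _ : UniformSpace Q := IsTopologicalAddGroup.rightUniformSpace Q
  have : FrechetSpace Q := FrechetSpace.quotient_leftIdeal J hJc
  -- A left ideal is enough, since the right action is by the scalars ε(c). With it, b ↦ b - ε(b) is
  -- a derivation: ab - ε(ab) = a (b - ε(b)) + ε(b) (a - ε(a)).
  let _ : Module Bᵐᵒᵖ Q := Module.compHom Q ((ε : B →+* ℂ).fromOpposite fun _ _ => mul_comm _ _)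
  have hop (c : B) (q : Q) : MulOpposite.op c • q = ε c • q := rfl
  have : SMulCommClass B Bᵐᵒᵖ Q := ⟨fun a c q => by
    change a • ε c.unop • q = ε c.unop • a • q
    rw [← algebraMap_smul B, ← algebraMap_smul B, smul_smul, smul_smul, Algebra.commutes]⟩
  have : IsScalarTower ℂ Bᵐᵒᵖ Q := ⟨fun z c q => by
    change ε (z • c.unop) • q = z • ε c.unop • q
    rw [map_smul, smul_assoc]⟩
  have : ContinuousSMul Bᵐᵒᵖ Q := ⟨by
    change Continuous fun p : Bᵐᵒᵖ × Q => ε p.1.unop • p.2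
    exact (ε.continuous.comp (MulOpposite.continuous_unop.comp continuous_fst)).smul
      continuous_snd⟩
  let D : B →L[ℂ] Q :=
    ⟨(J.mkQ.restrictScalars ℂ) ∘ₗ (LinearMap.id - (Algebra.linearMap ℂ B) ∘ₗ (ε : B →ₗ[ℂ] ℂ)),
      J.continuous_mkQ.comp (continuous_id.sub ((continuous_algebraMap ℂ B).comp ε.continuous))⟩
  have hD (b : B) : D b = J.mkQ (b - algebraMap ℂ B (ε b)) := rfl
  have h0 := IsFrechetEpi.derivation_eq_zero.{u, u} hφ D (fun a b => by
    rw [hop, hD, hD, hD, ← algebraMap_smul B, ← map_smul, ← map_smul, ← map_add]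
    congr 1
    rw [show ε (a * b) = ε b * ε a by rw [map_mul, mul_comm], map_mul, smul_eq_mul, smul_eq_mul,
      mul_sub, mul_sub, Algebra.commutes (ε b) a]
    abel) (fun a => (Submodule.Quotient.mk_eq_zero J).2
      (Submodule.le_topologicalClosure _ (Submodule.subset_span ⟨a, rfl⟩))) b
  exact (Submodule.Quotient.mk_eq_zero J).1 h0

end SquareZero

/-! ### Extending point derivations along transversal epimorphisms -/

section PointDerivations

open Filter Topology

variable {A : Type u} [Ring A] [Algebra ℂ A] [UniformSpace A]

/-- The two-dimensional module on which `a` acts by the matrix `(χ a, D a; 0, χ a)`, where `D` is a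
point derivation at the character `χ`. -/
noncomputable def pointDerivationModule (χ : A →A[ℂ] ℂ) (D : A →L[ℂ] ℂ)
    (hD : ∀ a b, D (a * b) = χ a * D b + χ b * D a) : LeftFrechetModule.{u, 0} A :=
  letI : Module A (ℂ × ℂ) :=
    { smul := fun a p => (χ a * p.1 + D a * p.2, χ a * p.2)
      one_smul := fun p => by
        have h := hD 1 1
        simp only [mul_one, map_one, one_mul, left_eq_add] at h
        change (χ 1 * p.1 + D 1 * p.2, χ 1 * p.2) = p
        simp [h]
      mul_smul := fun a b p => by
        change (χ (a * b) * p.1 + D (a * b) * p.2, χ (a * b) * p.2) =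
          (χ a * (χ b * p.1 + D b * p.2) + D a * (χ b * p.2), χ a * (χ b * p.2))
        rw [hD, map_mul]
        ext <;> ring
      smul_zero := fun a => by
        change (χ a * 0 + D a * 0, χ a * 0) = ((0, 0) : ℂ × ℂ)
        simp
      smul_add := fun a p q => by
        change (χ a * (p.1 + q.1) + D a * (p.2 + q.2), χ a * (p.2 + q.2)) =
          (χ a * p.1 + D a * p.2 + (χ a * q.1 + D a * q.2), χ a * p.2 + χ a * q.2)
        ext <;> ring
      add_smul := fun a b p => by
        change (χ (a + b) * p.1 + D (a + b) * p.2, χ (a + b) * p.2) =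
          (χ a * p.1 + D a * p.2 + (χ b * p.1 + D b * p.2), χ a * p.2 + χ b * p.2)
        rw [map_add, map_add]
        ext <;> ring
      zero_smul := fun p => by
        change (χ 0 * p.1 + D 0 * p.2, χ 0 * p.2) = ((0, 0) : ℂ × ℂ)
        simp }
  { carrier := ℂ × ℂ
    isScalarTowerLeft := ⟨fun z a p => by
      change (χ (z • a) * p.1 + D (z • a) * p.2, χ (z • a) * p.2) =
        (z * (χ a * p.1 + D a * p.2), z * (χ a * p.2))
      rw [map_smul, map_smul, smul_eq_mul, smul_eq_mul]
      ext <;> ring⟩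
    continuousSMulLeft := ⟨by
      change Continuous fun p : A × (ℂ × ℂ) =>
        (χ p.1 * p.2.1 + D p.1 * p.2.2, χ p.1 * p.2.2)
      have h1 : Continuous fun p : A × (ℂ × ℂ) => χ p.1 := χ.continuous.comp continuous_fst
      have h2 : Continuous fun p : A × (ℂ × ℂ) => D p.1 := D.continuous.comp continuous_fst
      fun_prop⟩ }

/-- The module of `D` is an extension of N by N that splits over ℂ, so η lifts to it. The first
coordinate of the lift is l, and linearity of the lift over A, read in that coordinate, is the
identity for l. -/
theorem LeftFrechetModule.IsProjective.exists_lift_pointDerivation {χ : A →A[ℂ] ℂ} {D : A →L[ℂ] ℂ}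
    (hD : ∀ a b, D (a * b) = χ a * D b + χ b * D a) {N P : LeftFrechetModule.{u, 0} A}
    (e : N.carrier ≃L[ℂ] ℂ) (he : ∀ (a : A) y, e (a • y) = χ a * e y) (hP : P.IsProjective)
    (η : P.Hom N) :
    ∃ l : P.carrier →L[ℂ] ℂ, ∀ (a : A) q, l (a • q) = χ a * l q + D a * e (η q) := by
  let Y := pointDerivationModule χ D hD
  let i : N.Hom Y :=
    { toFun := fun n => ((e n, 0) : ℂ × ℂ)
      map_add' := fun x y => by
        change ((e (x + y), 0) : ℂ × ℂ) = (e x + e y, 0 + 0)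
        rw [map_add, add_zero]
      map_smul' := fun a x => by
        change ((e (a • x), 0) : ℂ × ℂ) = (χ a * e x + D a * 0, χ a * 0)
        rw [he, mul_zero, mul_zero, add_zero]
      cont := e.continuous.prodMk continuous_const }
  let p : Y.Hom N :=
    { toFun := fun y : ℂ × ℂ => e.symm y.2
      map_add' := fun x y => map_add e.symm _ _
      map_smul' := fun a x => by
        change e.symm (χ a * (show ℂ × ℂ from x).2) = a • e.symm (show ℂ × ℂ from x).2
        apply e.injective
        rw [he, e.apply_symm_apply, e.apply_symm_apply]
      cont := e.symm.continuous.comp continuous_snd }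
  have hadm : IsAdmissibleShort i p := by
    refine ⟨fun x => map_zero e.symm,
      (e.symm : ℂ →L[ℂ] N.carrier).comp (ContinuousLinearMap.fst ℂ ℂ ℂ),
      (ContinuousLinearMap.inr ℂ ℂ ℂ).comp (e : N.carrier →L[ℂ] ℂ),
      fun x => e.symm_apply_apply x, fun y => ?_, fun z => e.symm_apply_apply z⟩
    obtain ⟨y₁, y₂⟩ := (show ℂ × ℂ from y)
    change ((e (e.symm y₁) + 0, 0 + e (e.symm y₂)) : ℂ × ℂ) = (y₁, y₂)
    rw [e.apply_symm_apply, e.apply_symm_apply, add_zero, zero_add]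
  obtain ⟨f, hf⟩ := (hP N Y N i p hadm).2.2 η
  have hf2 q : (show ℂ × ℂ from f q).2 = e (η q) := by
    rw [← hf]
    exact (e.apply_symm_apply _).symm
  refine ⟨(ContinuousLinearMap.fst ℂ ℂ ℂ).comp f.toComplex, fun a q => ?_⟩
  rw [← hf2]
  exact congrArg (fun y : ℂ × ℂ => y.1) (map_smul f a q)

end PointDerivations

/-! ### Construction of the extended derivation -/

section Extension

open Filter Topology

variable {A B : Type u} [Ring A] [Algebra ℂ A] [UniformSpace A]
  [Ring B] [Algebra ℂ B] [UniformSpace B] [FrechetAlgebra B]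

/-- In `B ⊗_A ℂ_ε` one has `b ⊗ 1 = ε(b) 1 ⊗ 1` when `A → B` is an epimorphism. -/
theorem IsFrechetEpi.tmul_sub_mem_balancedSubmodule {φ : A →A[ℂ] B} (hφ : IsFrechetEpi φ)
    (ε : B →A[ℂ] ℂ) {M : RightFrechetModule.{u, u} A} {N : LeftFrechetModule.{u, v} A}
    (m : B →L[ℂ] M.carrier) (hm : ∀ (a : A) b, m (b * φ a) = MulOpposite.op a • m b)
    (n : N.carrier) (hn : ∀ a : A, a • n = ε (φ a) • n) (b : B) :
    completedTmul (m (b - algebraMap ℂ B (ε b))) n ∈ balancedSubmodule M N := by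
  let T : B →L[ℂ] CompletedTensor M.carrier N.carrier := (completedTmulLeft n).comp m
  -- The left factor c is carried through the induction to absorb the coefficients of the left
  -- ideal. On a generator the tensor is exactly a balancing relation, because a • n = ε(φ a) • n.
  have hspan : ∀ x ∈ Submodule.span B {t | ∃ a, t = φ a - algebraMap ℂ B (ε (φ a))},
      ∀ c : B, T (c * x) ∈ balancedSubmodule M N := by
    intro x hx
    induction hx using Submodule.span_induction with
    | mem x hx =>
      obtain ⟨a, rfl⟩ := hx
      intro c
      refine Submodule.le_topologicalClosure _ (Submodule.subset_span ⟨m c, a, n, ?_⟩)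
      rw [mul_sub, map_sub, ← Algebra.commutes, ← Algebra.smul_def, map_smul, hn,
        completedTmul_smul, ← hm]
      rfl
    | zero => intro c; rw [mul_zero, map_zero]; exact zero_mem _
    | add x y _ _ hx hy => intro c; rw [mul_add, map_add]; exact add_mem (hx c) (hy c)
    | smul r x _ hx => intro c; rw [smul_eq_mul, ← mul_assoc]; exact hx _
  have hcl : (augmentationIdeal φ ε : Set B) ⊆ T ⁻¹' balancedSubmodule M N := by
    refine closure_minimal (fun x hx => ?_)
      ((Submodule.isClosed_topologicalClosure _).preimage T.continuous)
    simpa using hspan x hx 1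
  exact hcl (hφ.sub_mem_augmentationIdeal ε b)

/-- Used with left multiplication by an element of B, which gives the left B-action on B ⊗_A N. -/
theorem completedTensorMapLeft_mem_balancedSubmodule {M : RightFrechetModule.{u, v} A}
    {N : LeftFrechetModule.{u, w} A} (g : M.carrier →L[ℂ] M.carrier)
    (hg : ∀ (a : A) x, g (MulOpposite.op a • x) = MulOpposite.op a • g x)
    {t : CompletedTensor M.carrier N.carrier} (ht : t ∈ balancedSubmodule M N) :
    completedTensorMapLeft N.carrier g t ∈ balancedSubmodule M N := by
  suffices h : balancedSubmodule M N ≤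
      (balancedSubmodule M N).comap (completedTensorMapLeft N.carrier g).toLinearMap from h ht
  refine Submodule.topologicalClosure_minimal _ (Submodule.span_le.2 ?_)
    ((Submodule.isClosed_topologicalClosure _).preimage
      (completedTensorMapLeft N.carrier g).continuous)
  rintro _ ⟨x, a, y, rfl⟩
  refine Submodule.le_topologicalClosure _ (Submodule.subset_span ⟨g x, a, y, ?_⟩)
  change completedTensorMapLeft N.carrier g _ = _
  rw [map_sub, completedTensorMapLeft_tmul, completedTensorMapLeft_tmul, hg]

theorem completedTensorFunctional_eq_zero_of_mem_balancedSubmodule {M : RightFrechetModule.{u, v} A}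
    {N : LeftFrechetModule.{u, w} A} (f : M.carrier →L[ℂ] ℂ) (g : N.carrier →L[ℂ] ℂ) (χ : A → ℂ)
    (hf : ∀ (a : A) x, f (MulOpposite.op a • x) = χ a * f x)
    (hg : ∀ (a : A) y, g (a • y) = χ a * g y)
    {t : CompletedTensor M.carrier N.carrier} (ht : t ∈ balancedSubmodule M N) :
    completedTensorFunctional f g t = 0 := by
  suffices h : balancedSubmodule M N ≤
      LinearMap.ker (completedTensorFunctional f g).toLinearMap from h ht
  refine Submodule.topologicalClosure_minimal _ (Submodule.span_le.2 ?_)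
    (isClosed_singleton.preimage (completedTensorFunctional f g).continuous)
  rintro _ ⟨x, a, y, rfl⟩
  change completedTensorFunctional f g _ = 0
  rw [map_sub, completedTensorFunctional_tmul, completedTensorFunctional_tmul, hf, hg]
  ring

/-- A functional on `E` that is constant on the fibres of a closed linear relation between `E` and
`F` which is everywhere defined on `F` induces a continuous functional on `F`. -/
theorem exists_continuousLinearMap_of_closed_relation {E : Type v} [AddCommGroup E] [Module ℂ E]
    [UniformSpace E] [IsUniformAddGroup E] [ContinuousSMul ℂ E] [CompleteSpace E]
    [(uniformity E).IsCountablyGenerated]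
    {F : Type w} [AddCommGroup F] [Module ℂ F] [UniformSpace F] [FrechetSpace F]
    (X : Submodule ℂ (E × F)) (hX : IsClosed (X : Set (E × F))) (hs : ∀ y, ∃ x, (x, y) ∈ X)
    (f : E →L[ℂ] ℂ) (hf : ∀ x, (x, 0) ∈ X → f x = 0) :
    ∃ g : F →L[ℂ] ℂ, ∀ x y, (x, y) ∈ X → g y = f x := by
  have := FrechetSpace.countablyGenerated (E := F)
  have : CompleteSpace X := hX.completeSpace_coe
  have : (uniformity X).IsCountablyGenerated :=
    inferInstanceAs (uniformity (X : Set (E × F))).IsCountablyGenerated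
  have : IsUniformAddGroup X := inferInstanceAs (IsUniformAddGroup X.toAddSubgroup)
  have : FirstCountableTopology X := UniformSpace.firstCountableTopology X
  have huniq {x x' y} (h : (x, y) ∈ X) (h' : (x', y) ∈ X) : f x = f x' := by
    have h0 := hf (x - x') (by simpa using X.sub_mem h h')
    rwa [map_sub, sub_eq_zero] at h0
  choose c hc using hs
  let g : F →ₗ[ℂ] ℂ :=
    { toFun := fun y => f (c y)
      map_add' := fun y y' => by
        rw [← map_add]
        exact huniq (hc _) (X.add_mem (hc y) (hc y'))
      map_smul' := fun z y => by
        rw [RingHom.id_apply, ← map_smul]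
        exact huniq (hc _) (X.smul_mem z (hc y)) }
  let p : X →L[ℂ] F := (ContinuousLinearMap.snd ℂ E F).comp X.subtypeL
  have hp : Function.Surjective p := fun y => ⟨⟨(c y, y), hc y⟩, rfl⟩
  -- The relation is complete and metrizable, so its projection to F is a quotient map, and
  -- continuity of g can be checked after pulling back, where g becomes f on the first coordinate.
  have hpq := (p.isOpenMap_of_complete_of_baire hp).isQuotientMap p.continuous hp
  have hg : Continuous g := by
    rw [hpq.continuous_iff]
    have h : g ∘ p = f ∘ fun x : X => x.1.1 := by
      ext ⟨⟨x, y⟩, h⟩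
      exact huniq (hc y) h
    rw [h]
    exact f.continuous.comp (continuous_fst.comp continuous_subtype_val)
  exact ⟨⟨g, hg⟩, fun x y h => huniq (hc y) h⟩

/-- Taking M and N abstractly, with identifications `m` and `e`, keeps their A-actions apart from
the structures that B and ℂ carry themselves. -/
theorem exists_pointDerivation_extension {φ : A →A[ℂ] B} (hφ : IsFrechetEpi φ) (ε : B →A[ℂ] ℂ)
    {M : RightFrechetModule.{u, u} A} {N : LeftFrechetModule.{u, 0} A}
    (m : M.carrier ≃L[ℂ] B) (hm : ∀ (a : A) x, m (MulOpposite.op a • x) = m x * φ a)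
    (e : N.carrier ≃L[ℂ] ℂ) (he : ∀ (a : A) y, e (a • y) = ε (φ a) * e y)
    (hperp : IsTransversal 1 M N) (D : A →L[ℂ] ℂ)
    (hD : ∀ a b, D (a * b) = ε (φ a) * D b + ε (φ b) * D a) :
    ∃ D' : B →L[ℂ] ℂ, (∀ b c, D' (b * c) = ε b * D' c + ε c * D' b) ∧ ∀ a, D' (φ a) = D a := by
  obtain ⟨R, -, hex0, hex1⟩ := hperp
  replace hex1 := hex1 0 one_pos
  obtain ⟨s, h, hs, hh, -⟩ := R.admissible
  obtain ⟨l, hl⟩ := (R.projective 0).exists_lift_pointDerivation (χ := ε.comp φ) hD e he R.η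
  let d0 := completedTensorMap M.carrier (R.d 0).toComplex
  let d1 := completedTensorMap M.carrier (R.d 1).toComplex
  let n : N.carrier := e.symm 1
  have hn (a : A) : a • n = ε (φ a) • n := by
    apply e.injective
    rw [he, map_smul, smul_eq_mul]
  let q : (R.Q 0).carrier := s n
  let F : CompletedTensor M.carrier (R.Q 1).carrier →L[ℂ] ℂ :=
    completedTensorFunctional (ε.toContinuousLinearMap.comp (m : M.carrier →L[ℂ] B))
      (l.comp (R.d 0).toComplex)
  have hF (x : M.carrier) (y : (R.Q 1).carrier) : F (completedTmul x y) = ε (m x) * l (R.d 0 y) :=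
    completedTensorFunctional_tmul _ _ _ _
  have hFbal {t} (ht : t ∈ balancedSubmodule M (R.Q 1)) : F t = 0 := by
    refine completedTensorFunctional_eq_zero_of_mem_balancedSubmodule _ _ (fun a => ε (φ a))
      (fun a x => ?_) (fun a y => ?_) ht
    · change ε (m (MulOpposite.op a • x)) = ε (φ a) * ε (m x)
      rw [hm, map_mul, mul_comm]
    · change l (R.d 0 (a • y)) = ε (φ a) * l (R.d 0 y)
      -- The `D` term disappears because η ∘ d₀ = 0, so l ∘ d₀ is A-linear into ℂ_χ.
      rw [map_smul, hl, R.η_d, map_zero, mul_zero, add_zero]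
      rfl
  have hFd1 (v) : F (d1 v) = 0 := by
    have : F.comp d1 = 0 := CompletedTensor.ext fun x y => by
      change F (d1 (completedTmul x y)) = 0
      rw [completedTensorMap_tmul, hF]
      change ε (m x) * l (R.d 0 (R.d 1 y)) = 0
      rw [R.d_d, map_zero, mul_zero]
    exact DFunLike.congr_fun this v
  -- Vanishing of Tor₁: modulo balancing relations such a w is d₁ v, and F kills both.
  have hFker {w} (hw : d0 w ∈ balancedSubmodule M (R.Q 0)) : F w = 0 := by
    obtain ⟨v, hv⟩ := (hex1 (Submodule.Quotient.mk w)).1 ((Submodule.Quotient.mk_eq_zero _).2 hw)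
    obtain ⟨v, rfl⟩ := Submodule.Quotient.mk_surjective _ v
    have h1 : d1 v - w ∈ balancedSubmodule M (R.Q 1) := (Submodule.Quotient.eq _).1 hv
    have h2 := hFbal h1
    rwa [map_sub, hFd1, zero_sub, neg_eq_zero] at h2
  -- Subtracting ε(b) makes the image of z(b) in B ⊗_A ℂ_ε zero, which is what lets it lift along
  -- d₀.
  let z : B →L[ℂ] CompletedTensor M.carrier (R.Q 0).carrier :=
    (completedTmulLeft q).comp ((m.symm : B →L[ℂ] M.carrier).comp
      (ContinuousLinearMap.id ℂ B - ε.toContinuousLinearMap.smulRight (1 : B)))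
  have hz (b : B) : z b = completedTmul (m.symm (b - algebraMap ℂ B (ε b))) q := by
    rw [Algebra.algebraMap_eq_smul_one]
    rfl
  let X : Submodule ℂ (CompletedTensor M.carrier (R.Q 1).carrier × B) :=
    (balancedSubmodule M (R.Q 0)).comap
      ((d0.comp (ContinuousLinearMap.fst ℂ _ B)) - z.comp (ContinuousLinearMap.snd ℂ _ B)).toLinearMap
  have hXmem (w) (b : B) : (w, b) ∈ X ↔ d0 w - z b ∈ balancedSubmodule M (R.Q 0) := Iff.rfl
  have hXc : IsClosed (X : Set (CompletedTensor M.carrier (R.Q 1).carrier × B)) :=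
    (Submodule.isClosed_topologicalClosure _).preimage
      ((d0.comp (ContinuousLinearMap.fst ℂ _ B)) - z.comp (ContinuousLinearMap.snd ℂ _ B)).continuous
  have hm' (a : A) (b : B) : m.symm (b * φ a) = MulOpposite.op a • m.symm b := by
    apply m.injective
    rw [hm, m.apply_symm_apply, m.apply_symm_apply]
  have hXs (b : B) : ∃ w, (w, b) ∈ X := by
    have h1 : completedTensorMap M.carrier R.η.toComplex (z b) ∈ balancedSubmodule M N := by
      rw [hz, completedTensorMap_tmul]
      change completedTmul _ (R.η (s n)) ∈ _
      rw [hs]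
      exact hφ.tmul_sub_mem_balancedSubmodule ε (m.symm : B →L[ℂ] M.carrier) hm' n hn b
    obtain ⟨w, hw⟩ := (hex0 (Submodule.Quotient.mk (z b))).1 ((Submodule.Quotient.mk_eq_zero _).2 h1)
    obtain ⟨w, rfl⟩ := Submodule.Quotient.mk_surjective _ w
    exact ⟨w, (Submodule.Quotient.eq _).1 hw⟩
  have := CompletedTensor.uniformity_isCountablyGenerated M.carrier (R.Q 1).carrier
  have := UniformSpace.Completion.continuousSMul (ProjTensor M.carrier (R.Q 1).carrier)
  obtain ⟨D', hD'⟩ := exists_continuousLinearMap_of_closed_relation X hXc hXs F fun w hw => by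
    rw [hXmem, map_zero, sub_zero] at hw
    exact hFker hw
  refine ⟨D', fun b c => ?_, fun a => ?_⟩
  · obtain ⟨w, hw⟩ := hXs b
    obtain ⟨w', hw'⟩ := hXs c
    let g : M.carrier →L[ℂ] M.carrier :=
      (m.symm : B →L[ℂ] M.carrier).comp ((⟨LinearMap.mulLeft ℂ b, continuous_const_mul b⟩ : B →L[ℂ] B).comp (m : M.carrier →L[ℂ] B))
    have hg (x : M.carrier) : g x = m.symm (b * m x) := rfl
    have hgA (a : A) (x : M.carrier) : g (MulOpposite.op a • x) = MulOpposite.op a • g x := by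
      rw [hg, hm, ← mul_assoc, hm', hg]
    have hFg : F (completedTensorMapLeft (R.Q 1).carrier g w') = ε b * F w' := by
      have : F.comp (completedTensorMapLeft (R.Q 1).carrier g) = ε b • F :=
        CompletedTensor.ext fun x y => by
          change F (completedTensorMapLeft (R.Q 1).carrier g (completedTmul x y)) =
            ε b * F (completedTmul x y)
          rw [completedTensorMapLeft_tmul, hF, hF, hg, m.apply_symm_apply, map_mul, mul_assoc]
      exact DFunLike.congr_fun this w'
    have hdg : d0 (completedTensorMapLeft (R.Q 1).carrier g w') =
        completedTensorMapLeft (R.Q 0).carrier g (d0 w') := by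
      have : d0.comp (completedTensorMapLeft (R.Q 1).carrier g) =
          (completedTensorMapLeft (R.Q 0).carrier g).comp d0 :=
        CompletedTensor.ext fun x y => by
          change d0 (completedTensorMapLeft (R.Q 1).carrier g (completedTmul x y)) =
            completedTensorMapLeft (R.Q 0).carrier g (d0 (completedTmul x y))
          rw [completedTensorMapLeft_tmul, completedTensorMap_tmul, completedTensorMap_tmul,
            completedTensorMapLeft_tmul]
      exact DFunLike.congr_fun this w'
    -- This is bc - ε(bc) = b (c - ε(c)) + ε(c) (b - ε(b)) tensored with q. Hence b · w' + ε(c) w is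
    -- a preimage for bc.
    have hzg : completedTensorMapLeft (R.Q 0).carrier g (z c) + ε c • z b = z (b * c) := by
      rw [hz, hz, hz, completedTensorMapLeft_tmul]
      simp only [← completedTmulLeft_apply]
      rw [← map_smul, ← map_add, hg, m.apply_symm_apply, ← map_smul, ← map_add]
      congr 2
      have hbc : algebraMap ℂ B (ε (b * c)) = algebraMap ℂ B (ε c) * algebraMap ℂ B (ε b) := by
        rw [map_mul, mul_comm, map_mul]
      rw [hbc, mul_sub, smul_sub, Algebra.smul_def, Algebra.smul_def, Algebra.commutes (ε c) b]
      abel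
    have hmem : (completedTensorMapLeft (R.Q 1).carrier g w' + ε c • w, b * c) ∈ X := by
      rw [hXmem] at hw hw' ⊢
      rw [map_add, map_smul, hdg, ← hzg]
      have h1 := add_mem (completedTensorMapLeft_mem_balancedSubmodule g hgA hw')
        (Submodule.smul_mem _ (ε c) hw)
      rw [map_sub, smul_sub] at h1
      convert h1 using 1
      abel
    rw [hD' _ _ hmem, hD' _ _ hw, hD' _ _ hw', map_add, hFg, map_smul, smul_eq_mul]
  -- Since η(r) = 0, the homotopy gives r = d₀(h₀ r). Modulo balancing, z(φ(a)) equals 1 ⊗ r, so 1 ⊗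
  -- h₀ r is a preimage and D'(φ(a)) = l(r) = D(a).
  · let r : (R.Q 0).carrier := a • q - ε (φ a) • q
    have hηq : R.η q = n := hs n
    have hr : R.d 0 (h 0 r) = r := by
      have h1 : R.η r = 0 := by
        change R.η.toComplex (a • q - ε (φ a) • q) = 0
        rw [map_sub, map_smul R.η.toComplex (ε (φ a)) q]
        change R.η (a • q) - ε (φ a) • R.η q = 0
        rw [map_smul, hηq, hn, sub_self]
      have h2 := hh r
      rwa [h1, map_zero, add_zero] at h2
    have hmem : (completedTmul (m.symm 1) (h 0 r), φ a) ∈ X := by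
      rw [hXmem, completedTensorMap_tmul, hz]
      change completedTmul _ (R.d 0 (h 0 r)) - _ ∈ _
      rw [hr, ← neg_mem_iff]
      refine Submodule.le_topologicalClosure _ (Submodule.subset_span ⟨m.symm 1, a, q, ?_⟩)
      rw [completedTmul_sub, completedTmul_smul, ← hm', one_mul, neg_sub]
      simp only [← completedTmulLeft_apply]
      rw [Algebra.algebraMap_eq_smul_one, map_sub, map_sub, map_smul, map_smul]
      abel
    rw [hD' _ _ hmem, hF, hr, m.apply_symm_apply, map_one, one_mul, map_sub,
      map_smul l (ε (φ a)) q, hl, hηq]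
    change ε (φ a) * l q + D a * e (e.symm 1) - ε (φ a) * l q = D a
    rw [e.apply_symm_apply]
    ring

end Extension

/-! ### The bijection between the derivation spaces -/

theorem mainTheorem8 {A B : Type u}
    [Ring A] [Algebra ℂ A] [UniformSpace A] [FrechetAlgebra A]
    [Ring B] [Algebra ℂ B] [UniformSpace B] [FrechetAlgebra B]
    (φ : A →A[ℂ] B) (hφ : IsFrechetEpi φ) (ε : B →A[ℂ] ℂ)
    (hperp : IsTransversal 1 ((RightFrechetModule.regular B).restrict φ)
      ((charBimodule ε).toLeftFrechetModule.restrict φ)) :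
    Function.Bijective (derRestrict φ (charBimodule ε)) := by
  refine ⟨?_, ?_⟩
  · refine (injective_iff_map_eq_zero _).2 fun D hD => ?_
    let X := charBimodule ε
    have h := IsFrechetEpi.derivation_eq_zero.{u, 0} hφ (M := X.carrier) D.1 D.2
      fun a => DFunLike.congr_fun (congrArg Subtype.val hD) a
    exact Subtype.ext (ContinuousLinearMap.ext h)
  · rintro ⟨D, hD⟩
    obtain ⟨D', hmul, hext⟩ := exists_pointDerivation_extension hφ ε
      (M := (RightFrechetModule.regular B).restrict φ)
      (N := (charBimodule ε).toLeftFrechetModule.restrict φ)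
      (ContinuousLinearEquiv.refl ℂ B) (fun _ _ => rfl)
      (ContinuousLinearEquiv.refl ℂ ℂ) (fun _ _ => rfl) hperp D hD
    exact ⟨⟨D', hmul⟩, Subtype.ext (ContinuousLinearMap.ext hext)⟩
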